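/- Let $k$ be a field and let $A$ be a left artinian $k$-algebra (for example a finite-dimensional Frobenius algebra over $k$) with Jacobson radical $J(A)$. Let $S$ and $N$ be simple left $A$-modules, let $\pi:P_0\to S$ be a projective cover (a surjection from a projective module whose kernel is superfluous), put $\Omega^1S=\ker\pi\subseteq P_0$, and write $Hd(M)=M/J(A)M$ for the head of a module $M$. Each $f\in Hom_A(\Omega^1S,N)$ induces a homomorphism $\bar f:Hd(\Omega^1S)\to N$. An extension of $S$ by $N$ is a short exact sequence $E:0\to N\xrightarrow{i}B\xrightarrow{p}S\to 0$ of $A$-modules, with class $[E]\in Ext^1_A(S,N)$. Say that $f$ corresponds to $E$ if there is a homomorphism $\mu:P_0\to B$ with $p\mu=\pi$ and $\mu|_{\Omega^1S}=if$. Two extensions $E_1,E_2$ are proportional if there are isomorphisms $\sigma:N\to N$ and $\beta:B_1\to B_2$ with $\beta i_1=i_2\sigma$ and $p_2\beta=p_1$; they are equivalent if this holds with $\sigma=\mathrm{id}$. Then: 1. Every $f\in Hom_A(\Omega^1S,N)$ corresponds to some extension of $S$ by $N$, every such extension corresponds to exactly one $f$, and two extensions are equivalent if and only if the same $f$ corresponds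 to them. 2. If $f_1,f_2$ correspond to $E_1,E_2$, then $E_1$ and $E_2$ are proportional if and only if $\ker\bar f_1=\ker\bar f_2$. If $End_A(N)=k$, this holds if and only if $[E_2]=c\,[E_1]$ for some $c\in k$, $c\neq0$. 3. There is a $k$-linear isomorphism $Ext^1_A(S,N)\to Hom_A(Hd(\Omega^1S),N)$ which sends $[E]$ to $\bar f$ whenever $f$ corresponds to $E$. 4. $Hd(\Omega^1S)$ is an internal direct sum $N_1\oplus\dots\oplus N_r\oplus W$ with $r\ge0$, $N_i\cong N$ for all $i$, and $W$ without submodules isomorphic to $N$. For every such decomposition: if $End_A(N)=k$, then for any isomorphisms $\varphi_i:N_i\to N$ there is a $k$-linear isomorphism $k^r\to Hom_A(Hd(\Omega^1S),N)$ which sends $(c_1,\dots,c_r)$ to the homomorphism that is $c_i\varphi_i$ on $N_i$ and $0$ on $W$; and (without the assumption on $End_A(N)$) if $f_1,f_2$ correspond to $E_1,E_2$ and $N_{i_1}$, respectively $N_{i_2}$, is the only one of $N_1,\dots,N_r$ that is not contained in $\ker\bar f_1$, respectively $\ker\bar f_2$, then $E_1$ and $E_2$ are proportional if and only if $i_1=i_2$.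 5. Let $Hd(\Omega^1S)=N'\oplus R$ with $N'\cong N$, and let $L\subseteq\Omega^1S$ be the preimage of $R$. Then there is a non-split extension $E$ of $S$ by $N$ whose middle term, together with its map to $S$, is isomorphic to $P_0/L$ with the map to $S$ induced by $\pi$; and an extension $E'$ with corresponding homomorphism $f'$ is proportional to $E$ if and only if $\ker\bar f'=R$. Conversely, if $f$ corresponds to a non-split extension of $S$ by $N$, then $Hd(\Omega^1S)=N'\oplus\ker\bar f$ for some submodule $N'\cong N$. -/

import Mathlib

open CategoryTheory

universe u w

namespace ProportionalExt

section Modules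

variable {A : Type u} [Ring A]

/-- A projective cover of `S`: a surjection `π : P → S` from a projective module whose kernel is
superfluous. -/
structure IsProjectiveCover {P S : Type u} [AddCommGroup P] [Module A P] [AddCommGroup S]
    [Module A S] (π : P →ₗ[A] S) : Prop where
  projective : Module.Projective A P
  surjective : Function.Surjective π
  superfluous : ∀ U : Submodule A P, U ⊔ LinearMap.ker π = ⊤ → U = ⊤

/-- The Heller module `Ω¹ S`, computed from a projective cover `π : P → S`. -/
abbrev Omega {P S : Type u} [AddCommGroup P] [Module A P] [AddCommGroup S] [Module A S]
    (π : P →ₗ[A] S) : Submodule A P :=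
  LinearMap.ker π

variable (A) in
/-- The radical `J(A) M` of a module. -/
abbrev rad (M : Type u) [AddCommGroup M] [Module A M] : Submodule A M :=
  Ring.jacobson A • (⊤ : Submodule A M)

variable (A) in
/-- The head `M / J(A) M` of a module. -/
abbrev Hd (M : Type u) [AddCommGroup M] [Module A M] : Type u :=
  M ⧸ rad A M

theorem rad_le_ker {M N : Type u} [AddCommGroup M] [Module A M] [AddCommGroup N] [Module A N]
    [IsSimpleModule A N] (f : M →ₗ[A] N) : rad A M ≤ LinearMap.ker f := by
  intro x hx
  have h1 : x ∈ Module.jacobson A M := Ring.jacobson_smul_top_le A M hx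
  have h2 := Module.le_comap_jacobson f h1
  rw [Submodule.mem_comap, IsSemisimpleModule.jacobson_eq_bot] at h2
  simpa using h2

/-- The map `Hd M → N` induced by `f : M → N`, for a simple module `N`. -/
def headMap {M N : Type u} [AddCommGroup M] [Module A M] [AddCommGroup N] [Module A N]
    [IsSimpleModule A N] (f : M →ₗ[A] N) : Hd A M →ₗ[A] N :=
  (rad A M).liftQ f (rad_le_ker f)

/-- `Y` is an (internal) direct sum of the submodules `C 1, …, C r`, each isomorphic to `N`, and of
a submodule `W` with no submodule isomorphic to `N`. -/
structure IsSplitting {Y : Type u} (N : Type u) [AddCommGroup Y] [Module A Y] [AddCommGroup N]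
    [Module A N] {r : ℕ} (C : Fin r → Submodule A Y) (W : Submodule A Y) : Prop where
  iso : ∀ i, Nonempty (C i ≃ₗ[A] N)
  indep : iSupIndep C
  compl : IsCompl (⨆ i, C i) W
  not_iso : ∀ T : Submodule A Y, T ≤ W → IsEmpty (T ≃ₗ[A] N)

end Modules

/-- A short exact sequence `0 → N → B → S → 0`, that is, an extension of `S` by `N`. -/
structure Extension (A : Type u) [Ring A] (S N : Type u) [AddCommGroup S] [Module A S]
    [AddCommGroup N] [Module A N] where
  B : Type u
  [addCommGroup : AddCommGroup B]
  [module : Module A B]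
  i : N →ₗ[A] B
  p : B →ₗ[A] S
  injective : Function.Injective i
  surjective : Function.Surjective p
  exact : Function.Exact i p

attribute [instance] Extension.addCommGroup Extension.module

namespace Extension

variable {A : Type u} [Ring A] {S N N₁ N₂ : Type u} [AddCommGroup S] [Module A S]
  [AddCommGroup N] [Module A N] [AddCommGroup N₁] [Module A N₁] [AddCommGroup N₂] [Module A N₂]

/-- Proportional extensions: isomorphic by isomorphisms `σ : N₁ ≃ N₂`, `β : B₁ ≃ B₂` and the
identity of `S`. -/
def Proportional (E₁ : Extension A S N₁) (E₂ : Extension A S N₂) : Prop :=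
  ∃ (σ : N₁ ≃ₗ[A] N₂) (β : E₁.B ≃ₗ[A] E₂.B),
    (∀ x, β (E₁.i x) = E₂.i (σ x)) ∧ ∀ b, E₂.p (β b) = E₁.p b

/-- (Yoneda) equivalent extensions. -/
def Equivalent (E₁ E₂ : Extension A S N) : Prop :=
  ∃ β : E₁.B ≃ₗ[A] E₂.B, (∀ x, β (E₁.i x) = E₂.i x) ∧ ∀ b, E₂.p (β b) = E₁.p b

/-- Split extensions. -/
def Split (E : Extension A S N) : Prop :=
  ∃ s : S →ₗ[A] E.B, ∀ x, E.p (s x) = x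

/-- The short complex `N → B → S` in the category of modules. -/
abbrev shortComplex (E : Extension A S N) : ShortComplex (ModuleCat.{u} A) :=
  ShortComplex.mk (ModuleCat.ofHom E.i) (ModuleCat.ofHom E.p) (by
    ext x
    exact E.exact.apply_apply_eq_zero x)

theorem shortExact (E : Extension A S N) : E.shortComplex.ShortExact :=
  ModuleCat.shortComplex_shortExact _ E.exact E.injective E.surjective

/-- The class of an extension in `Ext¹_A(S, N)`. -/
noncomputable def extClass (E : Extension A S N) :
    Abelian.Ext (ModuleCat.of A S) (ModuleCat.of A N) 1 :=
  E.shortExact.extClass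

end Extension

/-- The homomorphism `f : Ω¹ S → N` corresponds to the extension `0 → N → B → S → 0`: there is
`μ : P → B` making the following diagram commute, where the rows are exact.
```
0 → Ω¹S → P → S → 0
     f↓   μ↓   ‖
0 →  N  → B → S → 0
``` -/
def Corresponds {A : Type u} [Ring A] {P S N : Type u} [AddCommGroup P] [Module A P]
    [AddCommGroup S] [Module A S] [AddCommGroup N] [Module A N] (π : P →ₗ[A] S)
    (f : Omega π →ₗ[A] N) (E : Extension A S N) : Prop :=
  ∃ μ : P →ₗ[A] E.B, (∀ x, E.p (μ x) = π x) ∧ ∀ x : Omega π, μ x = E.i (f x)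

/-- The preimage `L ⊆ Ω¹ S ⊆ P` of a submodule `R` of the head of `Ω¹ S`. -/
def preimage {A : Type u} [Ring A] {P S : Type u} [AddCommGroup P] [Module A P]
    [AddCommGroup S] [Module A S] (π : P →ₗ[A] S) (R : Submodule A (Hd A (Omega π))) :
    Submodule A P :=
  (R.comap (rad A (Omega π)).mkQ).map (Omega π).subtype

end ProportionalExt

/-! The theorem rests on one fact, `IsProjectiveCover.apply_eq_zero`: a homomorphism `P → N` to a
simple module vanishes on `Ω¹ S`. Hence the `f` belonging to an extension does not depend on the
lift `μ` of `π`. In the long exact sequence of `Hom(-, N)` for `0 → Ω¹ S → P → S → 0`, the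
restriction from `P` is zero and `Ext¹(P, N) = 0`, so the connecting map `Hom(Ω¹ S, N) → Ext¹(S, N)`
is bijective. Concretely, the extension of `f` is the pushout of the cover along `f`.

Proportionality changes `f` by an automorphism of `N`; as `N` is simple, the orbit of `f` is
determined by `ker f` (`ker_eq_ker_iff_exists_equiv`). Every `f` factors through the head, which is
semisimple, so what remains is Schur's lemma and complements in a semisimple module. -/

namespace ProportionalExt

/-! ### Heads and homomorphisms to a simple module -/

section Heads

variable {A : Type u} [Ring A] {M N : Type u} [AddCommGroup M] [Module A M] [AddCommGroup N]
  [Module A N]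

/-- The head is a module over `A / J(A)`, a semisimple ring because `A` is artinian, and
semisimplicity does not depend on which of the two rings acts. -/
instance isSemisimpleModule_hd [IsArtinianRing A] : IsSemisimpleModule A (Hd A M) := by
  have h : Module.IsTorsionBySet A (Hd A M) (Ring.jacobson A) := by
    rw [Module.isTorsionBySet_quotient_iff]
    exact fun m a ha => Submodule.smul_mem_smul ha trivial
  let _ := h.module
  exact (h.semilinearMap.isSemisimpleModule_iff_of_bijective Function.bijective_id).2
    inferInstance

theorem comap_ker_headMap [IsSimpleModule A N] (f : M →ₗ[A] N) :
    (LinearMap.ker (headMap f)).comap (rad A M).mkQ = LinearMap.ker f := by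
  rw [← LinearMap.ker_comp, headMap, Submodule.liftQ_mkQ]

theorem ker_headMap_eq_iff [IsSimpleModule A N] (f g : M →ₗ[A] N) :
    LinearMap.ker (headMap f) = LinearMap.ker (headMap g) ↔
      LinearMap.ker f = LinearMap.ker g := by
  rw [← comap_ker_headMap f, ← comap_ker_headMap g,
    (Submodule.comap_injective_of_surjective (rad A M).mkQ_surjective).eq_iff]

/-- A map to a simple module is zero or onto. If both are onto, each identifies `N` with the
quotient by the common kernel, and `σ` compares the identifications. -/
theorem ker_eq_ker_iff_exists_equiv [IsSimpleModule A N] (f g : M →ₗ[A] N) :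
    LinearMap.ker f = LinearMap.ker g ↔ ∃ σ : N ≃ₗ[A] N, g = σ.toLinearMap ∘ₗ f := by
  constructor
  · intro h
    rcases f.surjective_or_eq_zero with hf | rfl
    · have hg : Function.Surjective g := by
        refine g.surjective_or_eq_zero.resolve_right fun hg => ?_
        have h0 : f = 0 := by rw [← LinearMap.ker_eq_top, h, hg, LinearMap.ker_zero]
        have := IsSimpleModule.nontrivial A N
        obtain ⟨y, hy⟩ := exists_ne (0 : N)
        obtain ⟨x, rfl⟩ := hf y
        exact hy (by rw [h0, LinearMap.zero_apply])
      refine ⟨(f.quotKerEquivOfSurjective hf).symm ≪≫ₗ Submodule.quotEquivOfEq _ _ h ≪≫ₗ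
        g.quotKerEquivOfSurjective hg, LinearMap.ext fun x => ?_⟩
      have : (f.quotKerEquivOfSurjective hf).symm (f x) = Submodule.Quotient.mk x := by
        rw [LinearEquiv.symm_apply_eq]; rfl
      simp [this]
    · have : g = 0 := by rw [← LinearMap.ker_eq_top, ← h, LinearMap.ker_zero]
      exact ⟨LinearEquiv.refl A N, by simp [this]⟩
  · rintro ⟨σ, rfl⟩
    rw [LinearEquiv.ker_comp]

/-- Homomorphisms to a simple module are homomorphisms from the head. -/
def headMapEquiv (k : Type w) [Field k] [Algebra k A] [Module k N] [IsScalarTower k A N]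
    [IsSimpleModule A N] : (M →ₗ[A] N) ≃ₗ[k] (Hd A M →ₗ[A] N) where
  toFun := headMap
  invFun g := g ∘ₗ (rad A M).mkQ
  map_add' f g := by ext; rfl
  map_smul' c f := by ext; rfl
  left_inv f := by ext; rfl
  right_inv g := by ext; rfl

theorem eq_zero_of_headMap_eq_zero [IsSimpleModule A N] {f : M →ₗ[A] N} (h : headMap f = 0) :
    f = 0 :=
  LinearMap.ext fun x => LinearMap.congr_fun h (Submodule.Quotient.mk x)

end Heads

/-! ### Copies of a simple module in a semisimple module -/

section Splittings

variable {A : Type u} [Ring A] {Y N : Type u} [AddCommGroup Y] [Module A Y] [AddCommGroup N]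
  [Module A N]

theorem exists_isCompl_ker [IsSemisimpleModule A Y] [IsSimpleModule A N] {f : Y →ₗ[A] N}
    (hf : f ≠ 0) :
    ∃ N' : Submodule A Y, IsCompl N' (LinearMap.ker f) ∧ Nonempty (N' ≃ₗ[A] N) := by
  obtain ⟨N', h⟩ := exists_isCompl (LinearMap.ker f)
  exact ⟨N', h.symm, ⟨(Submodule.quotientEquivOfIsCompl _ _ h).symm ≪≫ₗ
    f.quotKerEquivOfSurjective (LinearMap.surjective_of_ne_zero hf)⟩⟩

/-- Otherwise a complement of the kernel would be a copy of `N` inside `W`. -/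
theorem eq_zero_of_forall_isEmpty [IsSemisimpleModule A Y] [IsSimpleModule A N]
    {W : Submodule A Y} (hW : ∀ T : Submodule A Y, T ≤ W → IsEmpty (T ≃ₗ[A] N))
    (g : W →ₗ[A] N) : g = 0 := by
  by_contra hg
  obtain ⟨T, -, ⟨e⟩⟩ := exists_isCompl_ker hg
  exact (hW (T.map W.subtype) (Submodule.map_subtype_le W T)).false
    ((Submodule.equivMapOfInjective _ W.injective_subtype T).symm ≪≫ₗ e)

theorem iSupIndep_range_comp_single {r : ℕ} {g : (Fin r → N) →ₗ[A] Y}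
    (hg : Function.Injective g) :
    iSupIndep fun i => LinearMap.range (g ∘ₗ LinearMap.single A (fun _ => N) i) := by
  rw [iSupIndep_iff_finsetSum_eq_zero_imp_eq_zero]
  intro s v hv h0
  choose! n hn using hv
  have h1 : g (∑ i ∈ s, Pi.single i (n i)) = g 0 := by
    rw [map_sum, map_zero, ← h0]
    exact Finset.sum_congr rfl fun i hi => hn i hi
  intro i hi
  have h2 := congrFun (hg h1) i
  rw [Finset.sum_apply, Finset.sum_eq_single_of_mem i hi, Pi.single_eq_same, Pi.zero_apply] at h2
  · rw [← hn i hi, h2, map_zero]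
  · intro j _ hj
    exact Pi.single_eq_of_ne hj.symm _

/-- The isotypic component of `N` is a finite power of `N` by noetherianity. It contains every copy
of `N`, so any complement `W` contains none. -/
theorem exists_isSplitting [IsSemisimpleModule A Y] [IsNoetherian A Y] [IsSimpleModule A N] :
    ∃ (r : ℕ) (C : Fin r → Submodule A Y) (W : Submodule A Y), IsSplitting N C W := by
  obtain ⟨W, hW⟩ := exists_isCompl (isotypicComponent A Y N)
  obtain ⟨r, ⟨e⟩⟩ := (IsIsotypicOfType.isotypicComponent A Y N).linearEquiv_fun
  let g : (Fin r → N) →ₗ[A] Y := (isotypicComponent A Y N).subtype ∘ₗ e.symm.toLinearMap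
  have hg : Function.Injective g :=
    (isotypicComponent A Y N).injective_subtype.comp e.symm.injective
  refine ⟨r, fun i => LinearMap.range (g ∘ₗ LinearMap.single A (fun _ => N) i), W, ?_, ?_, ?_, ?_⟩
  · exact fun i => ⟨(LinearEquiv.ofInjective (g ∘ₗ LinearMap.single A (fun _ => N) i)
      (hg.comp (Pi.single_injective (M := fun _ => N) i))).symm⟩
  · exact iSupIndep_range_comp_single hg
  · have : ⨆ i, LinearMap.range (g ∘ₗ LinearMap.single A (fun _ => N) i) =
        isotypicComponent A Y N := by
      simp_rw [LinearMap.range_comp _ g]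
      rw [← Submodule.map_iSup, LinearMap.iSup_range_single, Submodule.map_top,
        LinearMap.range_comp, LinearEquiv.range, Submodule.map_top, Submodule.range_subtype]
    rwa [this]
  · refine fun T hT => ⟨fun e' => ?_⟩
    have h1 : T ≤ isotypicComponent A Y N := le_sSup ⟨e'⟩
    have h2 : T = ⊥ := le_bot_iff.1 (hW.disjoint h1 hT)
    subst h2
    have := IsSimpleModule.nontrivial A N
    exact not_subsingleton N e'.symm.injective.subsingleton

namespace IsSplitting

variable {r : ℕ} {C : Fin r → Submodule A Y} {W : Submodule A Y}

theorem le_ker [IsSemisimpleModule A Y] [IsSimpleModule A N] (h : IsSplitting N C W)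
    (f : Y →ₗ[A] N) : W ≤ LinearMap.ker f := fun x hx => by
  simpa using LinearMap.congr_fun (eq_zero_of_forall_isEmpty h.not_iso (f ∘ₗ W.subtype)) ⟨x, hx⟩

theorem iSup_sup_eq_top (h : IsSplitting N C W) : (⨆ i, C i) ⊔ W = ⊤ :=
  h.compl.sup_eq_top

theorem hom_ext [IsSemisimpleModule A Y] [IsSimpleModule A N] (h : IsSplitting N C W)
    {f g : Y →ₗ[A] N} (hfg : ∀ i, ∀ x ∈ C i, f x = g x) : f = g := by
  rw [← LinearMap.eqLocus_eq_top, eq_top_iff, ← h.iSup_sup_eq_top]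
  refine sup_le (iSup_le hfg) fun x hx => ?_
  have h1 := h.le_ker f hx
  have h2 := h.le_ker g hx
  rw [LinearMap.mem_ker] at h1 h2
  rw [LinearMap.mem_eqLocus, h1, h2]

/-- The projection onto a summand. -/
theorem exists_proj (h : IsSplitting N C W) (i : Fin r) :
    ∃ q : Y →ₗ[A] C i, (∀ x : C i, q x = x) ∧ (∀ j ≠ i, ∀ x ∈ C j, q x = 0) ∧
      ∀ x ∈ W, q x = 0 := by
  have hd : Disjoint (C i) ((⨆ j ≠ i, C j) ⊔ W) := by
    have hi : C i ⊔ (⨆ j ≠ i, C j) = ⨆ j, C j := by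
      refine le_antisymm (sup_le (le_iSup C i) (iSup₂_le fun j _ => le_iSup C j))
        (iSup_le fun j => ?_)
      by_cases hj : j = i
      · exact hj ▸ le_sup_left
      · exact le_sup_of_le_right (le_iSup₂_of_le j hj le_rfl)
    -- Modularity: `C i` is disjoint from the other summands, and their joint sum is disjoint from
    -- `W`.
    exact (h.indep i).disjoint_sup_right_of_disjoint_sup_left (hi ▸ h.compl.disjoint)
  have hc : IsCompl (C i) ((⨆ j ≠ i, C j) ⊔ W) := by
    refine ⟨hd, codisjoint_iff_le_sup.2 ?_⟩
    rw [← h.iSup_sup_eq_top]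
    refine sup_le (iSup_le fun j => ?_) (le_sup_of_le_right le_sup_right)
    by_cases hj : j = i
    · exact hj ▸ le_sup_left
    · exact le_sup_of_le_right (le_sup_of_le_left (le_iSup₂_of_le j hj le_rfl))
  refine ⟨Submodule.projectionOnto _ _ hc,
    Submodule.projectionOnto_apply_left hc, fun j hj x hx => ?_, fun x hx => ?_⟩
  · exact (Submodule.projectionOnto_apply_eq_zero_iff hc).2
      (Submodule.mem_sup_left (Submodule.mem_iSup_of_mem j (Submodule.mem_iSup_of_mem hj hx)))
  · exact (Submodule.projectionOnto_apply_eq_zero_iff hc).2 (Submodule.mem_sup_right hx)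

/-- A map `f` vanishes on `W`, so it is determined by the endomorphisms `f ∘ (φ i)⁻¹` of `N`, which
are scalars by `hk`. -/
theorem exists_linearEquiv [IsSemisimpleModule A Y] [IsSimpleModule A N] {k : Type w} [Field k]
    [Algebra k A] [Module k N] [IsScalarTower k A N] (h : IsSplitting N C W)
    (hk : ∀ g : N →ₗ[A] N, ∃ c : k, ∀ x, g x = c • x) (φ : ∀ i, C i ≃ₗ[A] N) :
    ∃ Ψ : (Fin r → k) ≃ₗ[k] (Y →ₗ[A] N), ∀ c : Fin r → k,
      (∀ (i : Fin r) (x : C i), Ψ c x = c i • φ i x) ∧ ∀ x ∈ W, Ψ c x = 0 := by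
  choose q hq hq' hqW using h.exists_proj
  let Ψ : (Fin r → k) →ₗ[k] (Y →ₗ[A] N) :=
    ∑ i, (LinearMap.proj i : (Fin r → k) →ₗ[k] k).smulRight ((φ i).toLinearMap ∘ₗ q i)
  have hΨ : ∀ c y, Ψ c y = ∑ i, c i • φ i (q i y) := fun c y => by simp [Ψ]
  have hΨC : ∀ (c : Fin r → k) (i : Fin r) (x : C i), Ψ c x = c i • φ i x := by
    intro c i x
    rw [hΨ, Finset.sum_eq_single i, hq]
    · intro j _ hj
      rw [hq' j i hj.symm x x.2, map_zero, smul_zero]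
    · simp
  have := IsSimpleModule.nontrivial A N
  have hbij : Function.Bijective Ψ := by
    constructor
    · rw [injective_iff_map_eq_zero]
      intro c hc
      funext i
      obtain ⟨n, hn⟩ := exists_ne (0 : N)
      have h1 := hΨC c i ((φ i).symm n)
      rw [hc, LinearMap.zero_apply, LinearEquiv.apply_symm_apply] at h1
      exact (smul_eq_zero.1 h1.symm).resolve_right hn
    · intro f
      choose c hc using fun i => hk (f ∘ₗ (C i).subtype ∘ₗ (φ i).symm.toLinearMap)
      refine ⟨c, h.hom_ext fun i x hx => ?_⟩
      have h1 := hc i (φ i ⟨x, hx⟩)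
      simp only [LinearMap.comp_apply, LinearEquiv.coe_coe, LinearEquiv.symm_apply_apply,
        Submodule.subtype_apply] at h1
      rw [h1]
      exact hΨC c i ⟨x, hx⟩
  refine ⟨LinearEquiv.ofBijective Ψ hbij, fun c => ⟨hΨC c, fun x hx => ?_⟩⟩
  rw [LinearEquiv.ofBijective_apply, hΨ]
  exact Finset.sum_eq_zero fun i _ => by rw [hqW i x hx, map_zero, smul_zero]

/-- If `i₁ = i₂`, both maps are bijective on this summand by Schur's lemma and zero on the others
and on `W`, so they differ by an automorphism of `N`. -/
theorem ker_eq_ker_iff [IsSemisimpleModule A Y] [IsSimpleModule A N] (h : IsSplitting N C W)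
    {f g : Y →ₗ[A] N} {i₁ i₂ : Fin r} (hf : ∀ j, C j ≤ LinearMap.ker f ↔ j ≠ i₁)
    (hg : ∀ j, C j ≤ LinearMap.ker g ↔ j ≠ i₂) :
    LinearMap.ker f = LinearMap.ker g ↔ i₁ = i₂ := by
  constructor
  · intro hfg
    by_contra hne
    exact (hf i₁).1 (hfg ▸ (hg i₁).2 hne) rfl
  · rintro rfl
    obtain ⟨e⟩ := h.iso i₁
    have := IsSimpleModule.congr e
    have hbij : ∀ f : Y →ₗ[A] N, (∀ j, C j ≤ LinearMap.ker f ↔ j ≠ i₁) →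
        Function.Bijective (f ∘ₗ (C i₁).subtype) := by
      intro f hf
      refine LinearMap.bijective_of_ne_zero fun h0 => (hf i₁).1 (fun x hx => ?_) rfl
      simpa using LinearMap.congr_fun h0 ⟨x, hx⟩
    let ef := LinearEquiv.ofBijective _ (hbij f hf)
    let eg := LinearEquiv.ofBijective _ (hbij g hg)
    refine (ker_eq_ker_iff_exists_equiv f g).2 ⟨ef.symm ≪≫ₗ eg, h.hom_ext fun j x hx => ?_⟩
    by_cases hj : j = i₁
    · subst hj
      have : ef.symm (f x) = ⟨x, hx⟩ := by rw [LinearEquiv.symm_apply_eq]; rfl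
      simp only [LinearMap.comp_apply, LinearEquiv.coe_coe, LinearEquiv.trans_apply, this]
      rfl
    · have h1 := (hf j).2 hj hx
      have h2 := (hg j).2 hj hx
      rw [LinearMap.mem_ker] at h1 h2
      rw [h2, LinearMap.comp_apply, h1, map_zero]

end IsSplitting

end Splittings

/-! ### Equivalence and pushouts of extensions -/

namespace Extension

variable {A : Type u} [Ring A] {S M N : Type u} [AddCommGroup S] [Module A S]
  [AddCommGroup M] [Module A M] [AddCommGroup N] [Module A N]

theorem Equivalent.symm {E₁ E₂ : Extension A S N} (h : E₁.Equivalent E₂) : E₂.Equivalent E₁ := by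
  obtain ⟨β, hi, hp⟩ := h
  exact ⟨β.symm, fun x => by rw [← hi, LinearEquiv.symm_apply_apply],
    fun b => by rw [← hp, LinearEquiv.apply_symm_apply]⟩

theorem Equivalent.trans {E₁ E₂ E₃ : Extension A S N} (h : E₁.Equivalent E₂)
    (h' : E₂.Equivalent E₃) : E₁.Equivalent E₃ := by
  obtain ⟨β, hi, hp⟩ := h
  obtain ⟨γ, hi', hp'⟩ := h'
  exact ⟨β ≪≫ₗ γ, fun x => by simp [hi, hi'], fun b => by simp [hp, hp']⟩

/-- The short five lemma. -/
theorem Equivalent.of_hom {E₁ E₂ : Extension A S N} (β : E₁.B →ₗ[A] E₂.B)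
    (hi : ∀ x, β (E₁.i x) = E₂.i x) (hp : ∀ b, E₂.p (β b) = E₁.p b) : E₁.Equivalent E₂ := by
  refine ⟨LinearEquiv.ofBijective β ⟨?_, fun b => ?_⟩, hi, hp⟩
  · rw [injective_iff_map_eq_zero]
    intro b hb
    obtain ⟨n, rfl⟩ := (E₁.exact b).1 (by rw [← hp, hb, map_zero])
    rw [hi] at hb
    rw [E₂.injective (hb.trans (map_zero E₂.i).symm), map_zero]
  · obtain ⟨b₁, hb₁⟩ := E₁.surjective (E₂.p b)
    obtain ⟨n, hn⟩ := (E₂.exact (b - β b₁)).1 (by rw [map_sub, hp, hb₁, sub_self])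
    exact ⟨b₁ + E₁.i n, by rw [map_add, hi, hn, add_sub_cancel]⟩

/-- The submodule of `N × B` whose quotient is the pushout. -/
def pushoutRel (E : Extension A S M) (f : M →ₗ[A] N) : Submodule A (N × E.B) :=
  LinearMap.range (f.prod (-E.i))

theorem mem_pushoutRel {E : Extension A S M} {f : M →ₗ[A] N} {n : N} {b : E.B} :
    (n, b) ∈ E.pushoutRel f ↔ ∃ m, f m = n ∧ -E.i m = b := by
  simp [pushoutRel]

/-- The pushout of an extension along a homomorphism of the submodules. -/
def pushout (E : Extension A S M) (f : M →ₗ[A] N) : Extension A S N where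
  B := (N × E.B) ⧸ E.pushoutRel f
  i := (E.pushoutRel f).mkQ ∘ₗ LinearMap.inl A N E.B
  p := (E.pushoutRel f).liftQ (E.p ∘ₗ LinearMap.snd A N E.B) (by
    rintro ⟨n, b⟩ h
    obtain ⟨m, -, rfl⟩ := mem_pushoutRel.1 h
    simp [E.exact.apply_apply_eq_zero])
  injective := by
    rw [injective_iff_map_eq_zero]
    intro n hn
    obtain ⟨m, rfl, hm⟩ := mem_pushoutRel.1 ((Submodule.Quotient.mk_eq_zero _).1 hn)
    replace hm : E.i m = 0 := neg_eq_zero.1 hm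
    rw [E.injective (hm.trans (map_zero E.i).symm), map_zero]
  surjective s := by
    obtain ⟨b, rfl⟩ := E.surjective s
    exact ⟨(E.pushoutRel f).mkQ (0, b), rfl⟩
  exact b := by
    constructor
    · obtain ⟨⟨n, b⟩, rfl⟩ := (E.pushoutRel f).mkQ_surjective b
      intro h
      obtain ⟨m, rfl⟩ := (E.exact b).1 h
      -- Modulo the relations `(f m, -i m)`, the pair `(n, i m)` equals `(n + f m, 0)`.
      refine ⟨n + f m, (Submodule.Quotient.eq _).2 (mem_pushoutRel.2 ⟨m, ?_, ?_⟩)⟩ <;> simp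
    · rintro ⟨n, rfl⟩
      exact map_zero E.p

/-- The canonical map to the pushout. -/
def toPushout (E : Extension A S M) (f : M →ₗ[A] N) : E.B →ₗ[A] (E.pushout f).B :=
  (E.pushoutRel f).mkQ ∘ₗ LinearMap.inr A N E.B

theorem pushout_p_toPushout (E : Extension A S M) (f : M →ₗ[A] N) (b : E.B) :
    (E.pushout f).p (E.toPushout f b) = E.p b :=
  rfl

theorem toPushout_i (E : Extension A S M) (f : M →ₗ[A] N) (m : M) :
    E.toPushout f (E.i m) = (E.pushout f).i (f m) := by
  refine ((Submodule.Quotient.eq _).2 (mem_pushoutRel.2 ⟨-m, ?_, ?_⟩)) <;> simp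

theorem toPushout_surjective (E : Extension A S M) {f : M →ₗ[A] N} (hf : Function.Surjective f) :
    Function.Surjective (E.toPushout f) := by
  intro b
  obtain ⟨⟨n, b⟩, rfl⟩ := (E.pushoutRel f).mkQ_surjective b
  obtain ⟨m, rfl⟩ := hf n
  refine ⟨b + E.i m, (Submodule.Quotient.eq _).2 (mem_pushoutRel.2 ⟨-m, ?_, ?_⟩)⟩ <;> simp

/-- Together with `toPushout_surjective`, this identifies the middle term of the pushout along an
onto `f` with a quotient of `E.B`; for the cover this is `P / L`. -/
theorem ker_toPushout (E : Extension A S M) (f : M →ₗ[A] N) :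
    LinearMap.ker (E.toPushout f) = (LinearMap.ker f).map E.i := by
  ext b
  have h : b ∈ LinearMap.ker (E.toPushout f) ↔ ((0, b) : N × E.B) ∈ E.pushoutRel f :=
    Submodule.Quotient.mk_eq_zero _
  rw [h, mem_pushoutRel, Submodule.mem_map]
  constructor
  · rintro ⟨m, hm, rfl⟩
    exact ⟨-m, by simp [hm], map_neg _ _⟩
  · rintro ⟨m, hm, rfl⟩
    exact ⟨-m, by simpa using hm, by simp⟩

/-- A morphism of extensions over `f` identifies its target with the pushout along `f`. -/
theorem equivalent_pushout {E : Extension A S M} {f : M →ₗ[A] N} {E' : Extension A S N}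
    (μ : E.B →ₗ[A] E'.B) (hp : ∀ b, E'.p (μ b) = E.p b) (hi : ∀ m, μ (E.i m) = E'.i (f m)) :
    (E.pushout f).Equivalent E' := by
  refine Equivalent.of_hom ((E.pushoutRel f).liftQ (E'.i.coprod μ) ?_) (fun n => ?_) (fun b => ?_)
  · rintro ⟨n, b⟩ h
    obtain ⟨m, rfl, rfl⟩ := mem_pushoutRel.1 h
    simp [hi]
  · change E'.i n + μ 0 = E'.i n
    rw [map_zero, add_zero]
  · obtain ⟨⟨n, b⟩, rfl⟩ := (E.pushoutRel f).mkQ_surjective b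
    change E'.p (E'.i n + μ b) = E.p b
    rw [map_add, E'.exact.apply_apply_eq_zero, zero_add, hp]

end Extension

/-! ### Extensions and homomorphisms from `Ω¹ S` -/

section Cover

variable {A : Type u} [Ring A] {P S N : Type u} [AddCommGroup P] [Module A P]
  [AddCommGroup S] [Module A S] [AddCommGroup N] [Module A N] {π : P →ₗ[A] S}

/-- The extension `0 → Ω¹ S → P → S → 0`. -/
abbrev coverExtension (π : P →ₗ[A] S) (hπ : Function.Surjective π) : Extension A S (Omega π) where
  B := P
  i := (Omega π).subtype
  p := π
  injective := (Omega π).injective_subtype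
  surjective := hπ
  exact := LinearMap.exact_subtype_ker_map π

/-- `P` is cyclic: a preimage of a nonzero element of `S` generates `P` modulo the superfluous
kernel. -/
theorem IsProjectiveCover.finite [IsSimpleModule A S] (hπ : IsProjectiveCover π) :
    Module.Finite A P := by
  have := IsSimpleModule.nontrivial A S
  obtain ⟨s, hs⟩ := exists_ne (0 : S)
  obtain ⟨x, rfl⟩ := hπ.surjective s
  refine ⟨⟨{x}, ?_⟩⟩
  rw [Finset.coe_singleton]
  refine hπ.superfluous _ ?_
  rw [← Submodule.comap_map_eq, Submodule.map_span, Set.image_singleton,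
    IsSimpleModule.span_singleton_eq_top A hs, Submodule.comap_top]

/-- If `h` were nonzero on `Ω¹ S`, it would map `Ω¹ S` onto the simple module `N`. Then `ker h + Ω¹
S = P`, so superfluity gives `h = 0`. -/
theorem IsProjectiveCover.apply_eq_zero [IsSimpleModule A N] (hπ : IsProjectiveCover π)
    (h : P →ₗ[A] N) (x : Omega π) : h x = 0 := by
  by_contra hx
  have h0 : h ∘ₗ (Omega π).subtype ≠ 0 := fun h0 => hx (LinearMap.congr_fun h0 x)
  have h1 : LinearMap.ker h ⊔ LinearMap.ker π = ⊤ := by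
    rw [sup_comm, ← Submodule.comap_map_eq, ← (LinearMap.ker π).range_subtype,
      ← LinearMap.range_comp, LinearMap.range_eq_top.2 (LinearMap.surjective_of_ne_zero h0),
      Submodule.comap_top]
  have h2 := hπ.superfluous _ h1
  exact hx (LinearMap.mem_ker.1 (h2 ▸ Submodule.mem_top))

theorem corresponds_pushout (hπ : Function.Surjective π) (f : Omega π →ₗ[A] N) :
    Corresponds π f ((coverExtension π hπ).pushout f) :=
  ⟨(coverExtension π hπ).toPushout f, (coverExtension π hπ).pushout_p_toPushout f,
    (coverExtension π hπ).toPushout_i f⟩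

theorem exists_corresponds [Module.Projective A P] (E : Extension A S N) :
    ∃ f : Omega π →ₗ[A] N, Corresponds π f E := by
  obtain ⟨μ, hμ⟩ := Module.projective_lifting_property E.p π E.surjective
  have hμ' : ∀ x, E.p (μ x) = π x := LinearMap.congr_fun hμ
  have hr : ∀ x : Omega π, μ x ∈ LinearMap.range E.i := fun x =>
    (E.exact _).1 ((hμ' x).trans x.2)
  refine ⟨(LinearEquiv.ofInjective E.i E.injective).symm.toLinearMap ∘ₗ
    (μ ∘ₗ (Omega π).subtype).codRestrict _ hr, μ, hμ', fun x => ?_⟩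
  exact (congrArg Subtype.val
    ((LinearEquiv.ofInjective E.i E.injective).apply_symm_apply ⟨μ x, hr x⟩)).symm

/-- Two lifts of `π` differ by a map `P → N` followed by the inclusion `E.i`, and such a map
vanishes on `Ω¹ S`. -/
theorem Corresponds.unique [IsSimpleModule A N] (hπ : IsProjectiveCover π)
    {f g : Omega π →ₗ[A] N} {E : Extension A S N} (hf : Corresponds π f E)
    (hg : Corresponds π g E) : f = g := by
  obtain ⟨μ, hμ, hμf⟩ := hf
  obtain ⟨ν, hν, hνg⟩ := hg
  have hr : ∀ x, (μ - ν) x ∈ LinearMap.range E.i := fun x =>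
    (E.exact _).1 (by rw [LinearMap.sub_apply, map_sub, hμ, hν, sub_self])
  let h : P →ₗ[A] N := (LinearEquiv.ofInjective E.i E.injective).symm.toLinearMap ∘ₗ
    (μ - ν).codRestrict _ hr
  have hh : ∀ x, E.i (h x) = μ x - ν x := fun x => congrArg Subtype.val
    ((LinearEquiv.ofInjective E.i E.injective).apply_symm_apply ⟨(μ - ν) x, hr x⟩)
  refine LinearMap.ext fun x => E.injective ?_
  rw [← hμf, ← hνg, ← sub_eq_zero, ← hh, hπ.apply_eq_zero, map_zero]

theorem Corresponds.equivalent (hπ : Function.Surjective π) {f : Omega π →ₗ[A] N}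
    {E₁ E₂ : Extension A S N} (h₁ : Corresponds π f E₁) (h₂ : Corresponds π f E₂) :
    E₁.Equivalent E₂ := by
  obtain ⟨μ, hμ, hμf⟩ := h₁
  obtain ⟨ν, hν, hνf⟩ := h₂
  exact (Extension.equivalent_pushout (E := coverExtension π hπ) μ hμ hμf).symm.trans
    (Extension.equivalent_pushout (E := coverExtension π hπ) ν hν hνf)

theorem Corresponds.of_equivalent {f : Omega π →ₗ[A] N} {E₁ E₂ : Extension A S N}
    (h : Corresponds π f E₁) (h' : E₁.Equivalent E₂) : Corresponds π f E₂ := by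
  obtain ⟨μ, hμ, hμf⟩ := h
  obtain ⟨β, hi, hp⟩ := h'
  exact ⟨β.toLinearMap ∘ₗ μ, fun x => by simp [hp, hμ], fun x => by simp [hμf, hi]⟩

theorem Corresponds.equivalent_iff [IsSimpleModule A N] (hπ : IsProjectiveCover π)
    {f₁ f₂ : Omega π →ₗ[A] N} {E₁ E₂ : Extension A S N} (h₁ : Corresponds π f₁ E₁)
    (h₂ : Corresponds π f₂ E₂) : E₁.Equivalent E₂ ↔ f₁ = f₂ :=
  ⟨fun h => (h₁.of_equivalent h).unique hπ h₂,
    fun h => h₁.equivalent hπ.surjective (h ▸ h₂)⟩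

theorem Corresponds.proportional_iff [IsSimpleModule A N] (hπ : IsProjectiveCover π)
    {f₁ f₂ : Omega π →ₗ[A] N} {E₁ E₂ : Extension A S N} (h₁ : Corresponds π f₁ E₁)
    (h₂ : Corresponds π f₂ E₂) :
    E₁.Proportional E₂ ↔ ∃ σ : N ≃ₗ[A] N, f₂ = σ.toLinearMap ∘ₗ f₁ := by
  obtain ⟨μ, hμ, hμf⟩ := h₁
  constructor
  · rintro ⟨σ, β, hi, hp⟩
    refine ⟨σ, h₂.unique hπ ⟨β.toLinearMap ∘ₗ μ, fun x => ?_, fun x => ?_⟩⟩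
    · simp [hp, hμ]
    · simp [hμf, hi]
  · rintro ⟨σ, rfl⟩
    -- Twisting the inclusion of `E₁` by `σ⁻¹` gives an extension with the same `μ` whose
    -- homomorphism is `σ ∘ f₁`.
    let E : Extension A S N :=
      { B := E₁.B
        i := E₁.i ∘ₗ σ.symm.toLinearMap
        p := E₁.p
        injective := E₁.injective.comp σ.symm.injective
        surjective := E₁.surjective
        exact := fun b => by
          rw [E₁.exact b]
          exact (σ.symm.surjective.range_comp E₁.i ▸ Iff.rfl :
            b ∈ Set.range E₁.i ↔ b ∈ Set.range (E₁.i ∘ σ.symm)) }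
    have hE : Corresponds π (σ.toLinearMap ∘ₗ f₁) E := ⟨μ, hμ, fun x => by simp [E, hμf]⟩
    obtain ⟨β, hi, hp⟩ := hE.equivalent hπ.surjective h₂
    refine ⟨σ, β, fun x => ?_, hp⟩
    rw [← hi]
    simp [E]

theorem Corresponds.proportional_iff_ker [IsSimpleModule A N] (hπ : IsProjectiveCover π)
    {f₁ f₂ : Omega π →ₗ[A] N} {E₁ E₂ : Extension A S N} (h₁ : Corresponds π f₁ E₁)
    (h₂ : Corresponds π f₂ E₂) :
    E₁.Proportional E₂ ↔ LinearMap.ker (headMap f₁) = LinearMap.ker (headMap f₂) := by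
  rw [h₁.proportional_iff hπ h₂, ker_headMap_eq_iff, ker_eq_ker_iff_exists_equiv]

/-- A section `s` gives the lift `s ∘ π`, which is zero on `Ω¹ S`; conversely, a lift that is zero
on `Ω¹ S` descends to a section. -/
theorem Corresponds.split_iff [IsSimpleModule A N] (hπ : IsProjectiveCover π)
    {f : Omega π →ₗ[A] N} {E : Extension A S N} (h : Corresponds π f E) :
    E.Split ↔ f = 0 := by
  constructor
  · rintro ⟨s, hs⟩
    refine h.unique hπ ⟨s ∘ₗ π, fun x => hs _, fun x => ?_⟩
    rw [LinearMap.comp_apply, LinearMap.mem_ker.1 x.2]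
    simp
  · rintro rfl
    obtain ⟨μ, hμ, hμf⟩ := h
    have hk : LinearMap.ker π ≤ LinearMap.ker μ := fun x hx => by
      simpa using hμf ⟨x, hx⟩
    refine ⟨(LinearMap.ker π).liftQ μ hk ∘ₗ
      (π.quotKerEquivOfSurjective hπ.surjective).symm.toLinearMap, fun s => ?_⟩
    obtain ⟨x, rfl⟩ := hπ.surjective s
    have : (π.quotKerEquivOfSurjective hπ.surjective).symm (π x) = Submodule.Quotient.mk x := by
      rw [LinearEquiv.symm_apply_eq]; rfl
    simp [this, hμ]

theorem preimage_ker_headMap [IsSimpleModule A N] (f : Omega π →ₗ[A] N) :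
    preimage π (LinearMap.ker (headMap f)) = (LinearMap.ker f).map (Omega π).subtype := by
  rw [preimage, comap_ker_headMap]

/-- `E` is the pushout along the map `Ω¹ S → N` obtained by projecting the head onto `N'` along `R`;
its kernel is `L`. -/
theorem exists_extension_quotient_preimage [IsSimpleModule A N] (hπ : IsProjectiveCover π)
    {N' R : Submodule A (Hd A (Omega π))} (h : IsCompl N' R) (e : N' ≃ₗ[A] N) :
    ∃ E : Extension A S N, ¬ E.Split ∧
      (∃ e : (P ⧸ preimage π R) ≃ₗ[A] E.B, ∀ x, E.p (e ((preimage π R).mkQ x)) = π x) ∧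
      ∀ (f' : Omega π →ₗ[A] N) (E' : Extension A S N), Corresponds π f' E' →
        (E.Proportional E' ↔ LinearMap.ker (headMap f') = R) := by
  let g : Hd A (Omega π) →ₗ[A] N := e.toLinearMap ∘ₗ Submodule.projectionOnto _ _ h
  let f : Omega π →ₗ[A] N := g ∘ₗ (rad A (Omega π)).mkQ
  have hfg : headMap f = g := by ext; rfl
  have hR : LinearMap.ker (headMap f) = R := by
    rw [hfg, LinearEquiv.ker_comp, Submodule.ker_projectionOnto]
  have hf : Function.Surjective f :=
    (e.surjective.comp (LinearMap.range_eq_top.1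
      (Submodule.range_projectionOnto h))).comp (rad A (Omega π)).mkQ_surjective
  have hE := corresponds_pushout hπ.surjective f
  refine ⟨(coverExtension π hπ.surjective).pushout f, fun hs => ?_, ?_, fun f' E' h' => ?_⟩
  · have := IsSimpleModule.nontrivial A N
    obtain ⟨y, hy⟩ := exists_ne (0 : N)
    obtain ⟨x, rfl⟩ := hf y
    exact hy (by rw [(hE.split_iff hπ).1 hs, LinearMap.zero_apply])
  · have hL : preimage π R =
        LinearMap.ker ((coverExtension π hπ.surjective).toPushout f) := by
      rw [Extension.ker_toPushout, ← hR, preimage_ker_headMap]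
    exact ⟨Submodule.quotEquivOfEq _ _ hL ≪≫ₗ LinearMap.quotKerEquivOfSurjective _
      ((coverExtension π hπ.surjective).toPushout_surjective hf), fun x => rfl⟩
  · rw [hE.proportional_iff_ker hπ h', hR, eq_comm]

end Cover

/-! ### Comparison with `Ext¹` -/

section Ext

variable {k : Type w} [Field k] {A : Type u} [Ring A] [Algebra k A] {P S M N : Type u}
  [AddCommGroup P] [Module A P] [AddCommGroup S] [Module A S] [AddCommGroup M] [Module A M]
  [AddCommGroup N] [Module A N] [Module k N] [IsScalarTower k A N] {π : P →ₗ[A] S}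

open Abelian

variable (k N) in
/-- The connecting homomorphism `Hom_A(M, N) → Ext¹_A(S, N)` of an extension of `S` by `M`. -/
noncomputable def Extension.connecting (E : Extension A S M) :
    (M →ₗ[A] N) →ₗ[k] Ext (ModuleCat.of A S) (ModuleCat.of A N) 1 where
  toFun f := E.extClass.comp (Ext.mk₀ (ModuleCat.ofHom f)) (add_zero 1)
  map_add' f g := by
    rw [ModuleCat.ofHom_add, Ext.mk₀_add, Ext.comp_add]
  map_smul' c f := by
    have h : Ext.mk₀ (ModuleCat.ofHom (c • f)) = c • Ext.mk₀ (ModuleCat.ofHom f) := by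
      rw [← Ext.mk₀_smul]
      congr 1
      ext x
      -- Scalars of `k` act on morphisms of `ModuleCat A` through `A`; the scalar tower matches this
      -- with the given action on `N`.
      exact (algebraMap_smul A c (f x)).symm
    rw [h, Ext.comp_smul, RingHom.id_apply]

/-- Naturality of the class for a morphism of short exact sequences that is the identity on `S`. -/
theorem Extension.extClass_eq_connecting {E : Extension A S M} {E' : Extension A S N}
    {f : M →ₗ[A] N} (μ : E.B →ₗ[A] E'.B) (hp : ∀ b, E'.p (μ b) = E.p b)
    (hi : ∀ m, μ (E.i m) = E'.i (f m)) : E'.extClass = E.connecting k N f := by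
  let φ : E.shortComplex ⟶ E'.shortComplex :=
    { τ₁ := ModuleCat.ofHom f
      τ₂ := ModuleCat.ofHom μ
      τ₃ := 𝟙 _
      comm₁₂ := by
        ext x
        exact (hi x).symm
      comm₂₃ := by
        ext x
        exact hp x }
  have h := ShortComplex.ShortExact.extClass_naturality E.shortExact E'.shortExact φ
  exact (h.trans (Ext.mk₀_id_comp E'.extClass)).symm

/-- Injective: an `f` in the kernel extends to `P`, hence is zero on `Ω¹ S`. Surjective: `Ext¹(P, N)
= 0`. -/
theorem connecting_coverExtension_bijective [IsSimpleModule A N] (hπ : IsProjectiveCover π) :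
    Function.Bijective ((coverExtension π hπ.surjective).connecting k N) := by
  constructor
  · rw [injective_iff_map_eq_zero]
    intro f hf
    obtain ⟨y, hy⟩ := Ext.contravariant_sequence_exact₁
      (coverExtension π hπ.surjective).shortExact _ (Ext.mk₀ (ModuleCat.ofHom f)) (add_zero 1) hf
    obtain ⟨h, rfl⟩ := (Ext.mk₀_bijective _ _).2 y
    rw [Ext.mk₀_comp_mk₀] at hy
    have h1 := (Ext.mk₀_bijective _ _).1 hy
    ext x
    rw [LinearMap.zero_apply, ← hπ.apply_eq_zero h.hom x]
    exact (LinearMap.congr_fun (congrArg ModuleCat.Hom.hom h1) x).symm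
  · intro y
    have : Projective (coverExtension π hπ.surjective).shortComplex.X₂ := by
      have := hπ.projective
      exact ModuleCat.projective_of_categoryTheory_projective (ModuleCat.of A P)
    obtain ⟨x, hx⟩ := Ext.contravariant_sequence_exact₃
      (coverExtension π hπ.surjective).shortExact _ y (Ext.eq_zero_of_projective _) (add_zero 1)
    obtain ⟨f, rfl⟩ := (Ext.mk₀_bijective _ _).2 x
    exact ⟨f.hom, hx⟩

theorem exists_extEquiv [IsSimpleModule A N] (hπ : IsProjectiveCover π) :
    ∃ Φ : Ext (ModuleCat.of A S) (ModuleCat.of A N) 1 ≃ₗ[k] (Hd A (Omega π) →ₗ[A] N),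
      ∀ (f : Omega π →ₗ[A] N) (E : Extension A S N), Corresponds π f E →
        Φ E.extClass = headMap f := by
  refine ⟨(LinearEquiv.ofBijective _ (connecting_coverExtension_bijective hπ)).symm ≪≫ₗ
    headMapEquiv k, ?_⟩
  rintro f E ⟨μ, hμ, hμf⟩
  rw [Extension.extClass_eq_connecting (k := k) (E := coverExtension π hπ.surjective) μ hμ hμf,
    LinearEquiv.trans_apply]
  exact congrArg headMap (LinearEquiv.ofBijective_symm_apply_apply _ f)

theorem proportional_iff_extClass [IsSimpleModule A N] (hπ : IsProjectiveCover π)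
    (hk : ∀ g : N →ₗ[A] N, ∃ c : k, ∀ x, g x = c • x) (E₁ E₂ : Extension A S N) :
    E₁.Proportional E₂ ↔ ∃ c : k, c ≠ 0 ∧ E₂.extClass = c • E₁.extClass := by
  have := hπ.projective
  have := IsSimpleModule.nontrivial A N
  obtain ⟨Φ, hΦ⟩ := exists_extEquiv (k := k) (N := N) hπ
  obtain ⟨f₁, h₁⟩ := exists_corresponds (π := π) E₁
  obtain ⟨f₂, h₂⟩ := exists_corresponds (π := π) E₂
  have key : ∀ c : k, E₂.extClass = c • E₁.extClass ↔ f₂ = c • f₁ := fun c => by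
    rw [← Φ.injective.eq_iff, map_smul, hΦ _ _ h₁, hΦ _ _ h₂,
      ← (headMapEquiv (A := A) (M := Omega π) (N := N) k).injective.eq_iff, map_smul]
    rfl
  rw [h₁.proportional_iff hπ h₂]
  simp_rw [key]
  constructor
  · rintro ⟨σ, rfl⟩
    obtain ⟨c, hc⟩ := hk σ.toLinearMap
    refine ⟨c, ?_, LinearMap.ext fun x => hc _⟩
    rintro rfl
    obtain ⟨y, hy⟩ := exists_ne (0 : N)
    exact hy (σ.injective ((hc y).trans (by rw [zero_smul, map_zero])))
  · rintro ⟨c, hc, rfl⟩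
    refine ⟨LinearEquiv.ofLinearMap (c • LinearMap.id) (c⁻¹ • LinearMap.id) ?_ ?_,
      LinearMap.ext fun x => rfl⟩ <;> ext x <;> simp [smul_smul, hc]

end Ext

end ProportionalExt

open ProportionalExt in
theorem proposition10 {k : Type w} [Field k] {A : Type u} [Ring A] [Algebra k A]
    [IsArtinianRing A]
    {S N P : Type u} [AddCommGroup S] [Module A S] [IsSimpleModule A S]
    [AddCommGroup N] [Module A N] [IsSimpleModule A N] [Module k N] [IsScalarTower k A N]
    [AddCommGroup P] [Module A P] (π : P →ₗ[A] S) (hπ : IsProjectiveCover π) :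
    -- homomorphisms `Ω¹ S → N` versus extensions of `S` by `N` up to equivalence
    (∀ f : Omega π →ₗ[A] N, ∃ E : Extension A S N, Corresponds π f E) ∧
    (∀ E : Extension A S N, ∃! f : Omega π →ₗ[A] N, Corresponds π f E) ∧
    (∀ (f₁ f₂ : Omega π →ₗ[A] N) (E₁ E₂ : Extension A S N), Corresponds π f₁ E₁ →
      Corresponds π f₂ E₂ → (E₁.Equivalent E₂ ↔ f₁ = f₂)) ∧
    -- proportional extensions
    (∀ (f₁ f₂ : Omega π →ₗ[A] N) (E₁ E₂ : Extension A S N), Corresponds π f₁ E₁ →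
      Corresponds π f₂ E₂ →
      (E₁.Proportional E₂ ↔ LinearMap.ker (headMap f₁) = LinearMap.ker (headMap f₂))) ∧
    -- if `End_A(N) = k`: proportional means to be multiples of each other in `Ext¹`
    ((∀ g : N →ₗ[A] N, ∃ c : k, ∀ x, g x = c • x) → ∀ E₁ E₂ : Extension A S N,
      (E₁.Proportional E₂ ↔ ∃ c : k, c ≠ 0 ∧ E₂.extClass = c • E₁.extClass)) ∧
    -- `Ext¹_A(S, N) ≅ Hom_A(Hd(Ω¹ S), N)`, given by the above correspondence
    (∃ Φ : Abelian.Ext (ModuleCat.of A S) (ModuleCat.of A N) 1 ≃ₗ[k]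
        (Hd A (Omega π) →ₗ[A] N),
      ∀ (f : Omega π →ₗ[A] N) (E : Extension A S N), Corresponds π f E →
        Φ E.extClass = headMap f) ∧
    -- the head of `Ω¹ S` as a direct sum of `r` copies of `N` and a complement without `N`
    (∃ (r : ℕ) (C : Fin r → Submodule A (Hd A (Omega π))) (W : Submodule A (Hd A (Omega π))),
      IsSplitting N C W) ∧
    (∀ (r : ℕ) (C : Fin r → Submodule A (Hd A (Omega π))) (W : Submodule A (Hd A (Omega π))),
      IsSplitting N C W →
      -- `Hom_A(Hd(Ω¹ S), N) ≅ kʳ` if `End_A(N) = k`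
      ((∀ g : N →ₗ[A] N, ∃ c : k, ∀ x, g x = c • x) → ∀ φ : ∀ i, C i ≃ₗ[A] N,
        ∃ Ψ : (Fin r → k) ≃ₗ[k] (Hd A (Omega π) →ₗ[A] N), ∀ c : Fin r → k,
          (∀ (i : Fin r) (x : C i), Ψ c x = c i • φ i x) ∧ ∀ x ∈ W, Ψ c x = 0) ∧
      -- if only one summand is involved, this summand determines the proportionality class
      ∀ (f₁ f₂ : Omega π →ₗ[A] N) (E₁ E₂ : Extension A S N), Corresponds π f₁ E₁ →
        Corresponds π f₂ E₂ → ∀ i₁ i₂ : Fin r,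
        (∀ j, C j ≤ LinearMap.ker (headMap f₁) ↔ j ≠ i₁) →
        (∀ j, C j ≤ LinearMap.ker (headMap f₂) ↔ j ≠ i₂) →
        (E₁.Proportional E₂ ↔ i₁ = i₂)) ∧
    -- every direct summand `N' ≅ N` of the head, with complement `R`, gives the proportionality
    -- class of an extension with middle term `P / L`, `L` the preimage of `R`
    (∀ N' R : Submodule A (Hd A (Omega π)), IsCompl N' R → Nonempty (N' ≃ₗ[A] N) →
      ∃ E : Extension A S N, ¬ E.Split ∧
        (∃ e : (P ⧸ preimage π R) ≃ₗ[A] E.B,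
          ∀ x, E.p (e ((preimage π R).mkQ x)) = π x) ∧
        ∀ (f' : Omega π →ₗ[A] N) (E' : Extension A S N), Corresponds π f' E' →
          (E.Proportional E' ↔ LinearMap.ker (headMap f') = R)) ∧
    -- and every non-split extension arises in this way
    (∀ (f : Omega π →ₗ[A] N) (E : Extension A S N), Corresponds π f E → ¬ E.Split →
      ∃ N' : Submodule A (Hd A (Omega π)),
        IsCompl N' (LinearMap.ker (headMap f)) ∧ Nonempty (N' ≃ₗ[A] N)) := by
  have := hπ.projective
  have := hπ.finite
  -- Makes the head of `Ω¹ S` noetherian, so that the number `r` of summands is finite.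
  have : IsNoetherian A P := isNoetherian_of_isNoetherianRing_of_finite A P
  refine ⟨fun f => ⟨_, corresponds_pushout hπ.surjective f⟩, fun E => ?_,
    fun f₁ f₂ E₁ E₂ h₁ h₂ => h₁.equivalent_iff hπ h₂,
    fun f₁ f₂ E₁ E₂ h₁ h₂ => h₁.proportional_iff_ker hπ h₂,
    proportional_iff_extClass hπ, exists_extEquiv hπ, exists_isSplitting,
    fun r C W h => ⟨h.exists_linearEquiv, fun f₁ f₂ E₁ E₂ h₁ h₂ i₁ i₂ hi₁ hi₂ => ?_⟩,
    fun N' R h ⟨e⟩ => exists_extension_quotient_preimage hπ h e, fun f E h hs => ?_⟩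
  · obtain ⟨f, hf⟩ := exists_corresponds (π := π) E
    exact ⟨f, hf, fun g hg => hg.unique hπ hf⟩
  · rw [h₁.proportional_iff_ker hπ h₂, h.ker_eq_ker_iff hi₁ hi₂]
  · exact exists_isCompl_ker fun h0 => hs ((h.split_iff hπ).2 (eq_zero_of_headMap_eq_zero h0))
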